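/- Proposition (dynamics of $U$). Let $(\Omega,\mathcal F,(\mathcal F_t)_{t\ge 0},P)$ be a filtered probability space carrying a standard $(\mathcal F_t)$-Brownian motion $W$, let $a\ge 0$ and $b,c\in\mathbb R$, and let $V$ be a square-root process, that is, a nonnegative, continuous, adapted solution of $$V_t=V_0+\int_0^t (a+bV_r)\,dr+c\int_0^t\sqrt{V_r}\,dW_r,\qquad t\ge 0.$$ For $0\le s\le t$ put $U_{s,t}=\int_s^t V_r\,dr$ and $Z_{s,t}=\int_s^t\sqrt{V_r}\,dW_r$, where the Itô integral is taken in a version with continuous paths in $t\ge s$. Then for every $s\ge 0$ the process $(Z_{s,t})_{t\ge s}$ is well defined (a continuous version of the Itô integral exists), and, for every such version, almost surely, for all $t\ge s$, $$U_{s,t}=V_s\,\frac{e^{b(t-s)}-1}{b}+\frac ab\left(\frac{e^{b(t-s)}-1}{b}-(t-s)\right)+c\int_s^t e^{b(t-r)}Z_{s,r}\,dr .$$ For $b=0$ the conventions $\frac{e^{bx}-1}{b}=x$ and $\frac1b\left(\frac{e^{bx}-1}{b}-x\right)=\frac{x^2}{2}$ are used. -/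

import Mathlib

open MeasureTheory ProbabilityTheory Filter Topology
open scoped NNReal ENNReal

noncomputable section

namespace SquareRootProcess

variable {Ω : Type*} {mΩ : MeasurableSpace Ω}

/-- `W` is a standard Brownian motion relative to the filtration `𝓕`: it is a standard Brownian
motion, it is adapted, and the increment `W t - W s` is independent of `𝓕 s` for `s ≤ t`. -/
structure IsBrownianMotion (𝓕 : Filtration ℝ≥0 mΩ) (P : Measure Ω) (W : ℝ≥0 → Ω → ℝ) : Prop where
  isBrownian : IsBrownianReal W P
  adapted : StronglyAdapted 𝓕 W
  indep_increment : ∀ s t : ℝ≥0, s ≤ t →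
    Indep (MeasurableSpace.comap (fun ω => W t ω - W s ω) inferInstance) (𝓕 s) P

/-- A simple (elementary predictable) process
`∑ i < n, ξ i · 1_{(τ i, τ (i+1)]}` with deterministic times `τ 0 ≤ τ 1 ≤ ...` and bounded
coefficients `ξ i` that are measurable with respect to `𝓕 (τ i)`. -/
structure SimpleProcess (𝓕 : Filtration ℝ≥0 mΩ) where
  n : ℕ
  τ : ℕ → ℝ≥0
  mono : Monotone τ
  ξ : ℕ → Ω → ℝ
  measurable_coeff : ∀ i, StronglyMeasurable[𝓕 (τ i)] (ξ i)
  bounded_coeff : ∃ C : ℝ, ∀ i ω, |ξ i ω| ≤ C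

namespace SimpleProcess

variable {𝓕 : Filtration ℝ≥0 mΩ}

/-- The value at time `r` of a simple process. -/
def eval (η : SimpleProcess 𝓕) (r : ℝ≥0) (ω : Ω) : ℝ :=
  ∑ i ∈ Finset.range η.n, (Set.Ioc (η.τ i) (η.τ (i + 1))).indicator (fun _ => η.ξ i ω) r

/-- The elementary stochastic integral `∫_s^t η dW` of a simple process, for `s ≤ t`: the
`i`-th coefficient is multiplied by the increment of `W` over `(τ i, τ (i+1)] ∩ (s, t]`. -/
def integral (η : SimpleProcess 𝓕) (W : ℝ≥0 → Ω → ℝ) (s t : ℝ≥0) (ω : Ω) : ℝ :=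
  ∑ i ∈ Finset.range η.n,
    η.ξ i ω * (W (max s (min (η.τ (i + 1)) t)) ω - W (max s (min (η.τ i) t)) ω)

end SimpleProcess

/-- `Z` is (a continuous version of) the Itô integral process `t ↦ ∫_s^t H dW`, `t ≥ s`, of the
adapted process `H`: it has almost surely continuous paths on `[s, ∞)`, and there are simple
processes `η k` such that, as `k → ∞`, `∫_s^T |η k - H|² dr → 0` in probability for every `T`
and `∫_s^t η k dW → Z t` in probability for every `t ≥ s`. -/
structure IsItoIntegral (𝓕 : Filtration ℝ≥0 mΩ) (P : Measure Ω) (W : ℝ≥0 → Ω → ℝ) (s : ℝ≥0)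
    (H : ℝ≥0 → Ω → ℝ) (Z : ℝ≥0 → Ω → ℝ) : Prop where
  adapted : StronglyAdapted 𝓕 H
  measurable_paths : ∀ᵐ ω ∂P, Measurable fun r => H r ω
  continuous_paths : ∀ᵐ ω ∂P, ContinuousOn (fun t => Z t ω) (Set.Ici s)
  exists_approx : ∃ η : ℕ → SimpleProcess 𝓕,
    (∀ T : ℝ≥0, ∀ ε : ℝ≥0∞, 0 < ε →
      Tendsto (fun k => P {ω | ε ≤ ∫⁻ r in Set.Ioc (s : ℝ) T,
        ‖(η k).eval r.toNNReal ω - H r.toNNReal ω‖ₑ ^ 2}) atTop (𝓝 0)) ∧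
    (∀ t : ℝ≥0, s ≤ t →
      TendstoInMeasure P (fun k ω => (η k).integral W s t ω) atTop (Z t))

/-- `V` is a square-root process driven by `W`: a nonnegative continuous adapted solution of
`V_t = V_0 + ∫_0^t (a + b V_r) dr + c ∫_0^t √V_r dW_r`. The initial value `V_0` may be random. -/
structure IsSquareRootProcess (𝓕 : Filtration ℝ≥0 mΩ) (P : Measure Ω) (W : ℝ≥0 → Ω → ℝ)
    (a b c : ℝ) (V : ℝ≥0 → Ω → ℝ) : Prop where
  adapted : StronglyAdapted 𝓕 V
  continuous_paths : ∀ᵐ ω ∂P, Continuous fun t => V t ω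
  nonneg : ∀ᵐ ω ∂P, ∀ t, 0 ≤ V t ω
  equation : ∃ M : ℝ≥0 → Ω → ℝ, IsItoIntegral 𝓕 P W 0 (fun r ω => √(V r ω)) M ∧
    ∀ᵐ ω ∂P, ∀ t : ℝ≥0,
      V t ω = V 0 ω + (∫ r in (0 : ℝ)..t, (a + b * V r.toNNReal ω)) + c * M t ω

/-- The integrated process `U_{s,t} = ∫_s^t V_r dr`. -/
def integratedProcess (V : ℝ≥0 → Ω → ℝ) (s t : ℝ≥0) (ω : Ω) : ℝ :=
  ∫ r in (s : ℝ)..t, V r.toNNReal ω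

/-- `(e^{bx} - 1) / b`, with the convention that this is `x` for `b = 0`. -/
def expQuot (b x : ℝ) : ℝ :=
  if b = 0 then x else (Real.exp (b * x) - 1) / b

/-- `((e^{bx} - 1) / b - x) / b`, with the convention that this is `x² / 2` for `b = 0`. -/
def expQuot₂ (b x : ℝ) : ℝ :=
  if b = 0 then x ^ 2 / 2 else ((Real.exp (b * x) - 1) / b - x) / b

end SquareRootProcess

end

noncomputable section

namespace SquareRootProcess

variable {Ω : Type*} {mΩ : MeasurableSpace Ω} {𝓕 : Filtration ℝ≥0 mΩ} {P : Measure Ω}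
  {W : ℝ≥0 → Ω → ℝ}

/-! Almost surely `Z` agrees on `[s, ∞)` with `M t - M s`, where `M` is the stochastic integral in
the equation of `V`. Subtracting that equation at time `s` from the one at time `t` leaves, path by
path, `V_t = V_s + a (t - s) + b U_{s,t} + c Z_{s,t}`. Since `U' = V`, this is a linear ODE for `U`,
solved with the integrating factor `e^{b(t-r)}` (`integral_eq_of_linear_equation`); no stochastic
calculus enters here.

Existence of `Z` comes from `IsItoIntegral.restart`. The main work is uniqueness,
`IsItoIntegral.ae_eq`: two versions may come with different approximating simple processes.
Lenglart's inequality bounds the probability that two elementary integrals differ by at least `ε` by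
the probability that the integrands are far apart in `L²(dr)`, plus `δ / ε²`. It follows from the
discrete Itô isometry on a common refinement, after the integrand is cut off before its quadratic
variation reaches `δ`. Being a bound in probability, it needs no moments of the limiting integrand.
Hence versions agree almost surely at each time, and by continuity at all times simultaneously. -/

/-- The discrete stochastic integral `∑ l < m, D l (W (σ (l+1)) - W (σ l))`. -/
def discreteIntegral (W : ℝ≥0 → Ω → ℝ) (σ : ℕ → ℝ≥0) (D : ℕ → Ω → ℝ) (m : ℕ) (ω : Ω) : ℝ :=
  ∑ l ∈ Finset.range m, D l ω * (W (σ (l + 1)) ω - W (σ l) ω)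

/-- The quadratic variation `∑ l < m, (D l)² (σ (l+1) - σ l)` of the discrete integrand. -/
def discreteVariation (σ : ℕ → ℝ≥0) (D : ℕ → Ω → ℝ) (m : ℕ) (ω : Ω) : ℝ :=
  ∑ l ∈ Finset.range m, D l ω ^ 2 * ((σ (l + 1) : ℝ) - σ l)

/-! ### Brownian increments, discrete Itô isometry and Lenglart inequality. -/

namespace IsBrownianMotion

lemma memLp_increment (hW : IsBrownianMotion 𝓕 P W) (s t : ℝ≥0) :
    MemLp (fun ω => W t ω - W s ω) 2 P := by
  have h := hW.isBrownian.toIsPreBrownianReal.hasLaw_sub t s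
  have h2 : HasGaussianLaw (W t - W s) P := ⟨by rw [h.map_eq]; infer_instance⟩
  exact h2.memLp (by simp)

lemma integral_increment (hW : IsBrownianMotion 𝓕 P W) (s t : ℝ≥0) :
    ∫ ω, (W t ω - W s ω) ∂P = 0 := by
  have h := hW.isBrownian.toIsPreBrownianReal.hasLaw_sub t s
  have := h.integral_eq
  rw [integral_id_gaussianReal] at this
  exact this

lemma integral_increment_sq [IsProbabilityMeasure P] (hW : IsBrownianMotion 𝓕 P W) {s t : ℝ≥0}
    (hst : s ≤ t) : ∫ ω, (W t ω - W s ω) ^ 2 ∂P = (t : ℝ) - s := by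
  have h := hW.isBrownian.toIsPreBrownianReal.hasLaw_sub t s
  have hv := h.variance_eq
  rw [variance_id_gaussianReal, variance_of_integral_eq_zero h.aemeasurable
    (hW.integral_increment s t)] at hv
  refine hv.trans ?_
  rw [coe_nndist, Real.dist_eq]
  exact abs_of_nonneg (sub_nonneg.2 (by exact_mod_cast hst))

/-- The increment is independent of `𝓕 s`. Taking `f = id` kills the cross terms in the isometry; `f
= (· ^ 2)` produces the factor `t - s`. -/
lemma integral_mul_increment (hW : IsBrownianMotion 𝓕 P W) {s t : ℝ≥0} (hst : s ≤ t)
    {X : Ω → ℝ} (hX : StronglyMeasurable[𝓕 s] X) (f : ℝ → ℝ) (hf : Measurable f) :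
    ∫ ω, X ω * f (W t ω - W s ω) ∂P = (∫ ω, X ω ∂P) * ∫ ω, f (W t ω - W s ω) ∂P := by
  have hind : IndepFun X (fun ω => W t ω - W s ω) P := by
    rw [IndepFun_iff_Indep]
    exact (indep_of_indep_of_le_right (hW.indep_increment s t hst) hX.measurable.comap_le).symm
  have hWm : Measurable fun ω => W t ω - W s ω :=
    ((hW.adapted t).mono (𝓕.le t)).measurable.sub ((hW.adapted s).mono (𝓕.le s)).measurable
  exact (hind.comp measurable_id hf).integral_fun_mul_eq_mul_integral
    (hX.mono (𝓕.le s)).aestronglyMeasurable (hf.comp hWm).aestronglyMeasurable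

variable {σ : ℕ → ℝ≥0} {D : ℕ → Ω → ℝ}

lemma stronglyMeasurable_discreteIntegral (hW : IsBrownianMotion 𝓕 P W) (hσ : Monotone σ)
    (hD : ∀ l, StronglyMeasurable[𝓕 (σ l)] (D l)) (m : ℕ) :
    StronglyMeasurable[𝓕 (σ m)] (discreteIntegral W σ D m) := by
  unfold discreteIntegral
  refine Finset.stronglyMeasurable_fun_sum _ fun l hl => ?_
  have hl : l < m := Finset.mem_range.1 hl
  exact ((hD l).mono (𝓕.mono (hσ hl.le))).mul
    (((hW.adapted _).mono (𝓕.mono (hσ hl))).sub ((hW.adapted _).mono (𝓕.mono (hσ hl.le))))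

lemma memLp_discreteIntegral (hW : IsBrownianMotion 𝓕 P W)
    (hD : ∀ l, StronglyMeasurable[𝓕 (σ l)] (D l)) {C : ℝ} (hC : ∀ l ω, |D l ω| ≤ C) (m : ℕ) :
    MemLp (discreteIntegral W σ D m) 2 P := by
  unfold discreteIntegral
  refine memLp_finsetSum _ fun l _ => ?_
  have hinc := hW.memLp_increment (σ l) (σ (l + 1))
  refine hinc.of_le_mul (c := C)
    (((hD l).mono (𝓕.le _)).aestronglyMeasurable.mul hinc.1) (ae_of_all _ fun ω => ?_)
  rw [norm_mul]
  exact mul_le_mul_of_nonneg_right (hC l ω) (norm_nonneg _)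

/-- The Itô isometry for discrete integrands. -/
lemma integral_discreteIntegral_sq [IsProbabilityMeasure P] (hW : IsBrownianMotion 𝓕 P W)
    (hσ : Monotone σ) (hD : ∀ l, StronglyMeasurable[𝓕 (σ l)] (D l)) {C : ℝ}
    (hC : ∀ l ω, |D l ω| ≤ C) (m : ℕ) :
    ∫ ω, discreteIntegral W σ D m ω ^ 2 ∂P = ∫ ω, discreteVariation σ D m ω ∂P := by
  have hDm : ∀ l, AEStronglyMeasurable (D l) P := fun l =>
    ((hD l).mono (𝓕.le _)).aestronglyMeasurable
  have hDp : ∀ l, MemLp (D l) 2 P := fun l =>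
    MemLp.of_bound (hDm l) C (ae_of_all _ fun ω => hC l ω)
  have hQ : ∀ m, Integrable (discreteVariation σ D m) P := fun m => by
    unfold discreteVariation
    exact integrable_finsetSum _ fun l _ => (hDp l).integrable_sq.mul_const _
  induction m with
  | zero => simp [discreteIntegral, discreteVariation]
  | succ m ih =>
    have hle : σ m ≤ σ (m + 1) := hσ m.le_succ
    set S := discreteIntegral W σ D m with hS
    set Y : Ω → ℝ := fun ω => W (σ (m + 1)) ω - W (σ m) ω with hY
    have hSp : MemLp S 2 P := hW.memLp_discreteIntegral hD hC m
    have hYp : MemLp Y 2 P := hW.memLp_increment _ _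
    have hDY : MemLp (fun ω => D m ω * Y ω) 2 P := by
      refine hYp.of_le_mul (c := C) ((hDm m).mul hYp.1) (ae_of_all _ fun ω => ?_)
      rw [norm_mul]
      exact mul_le_mul_of_nonneg_right (hC m ω) (norm_nonneg _)
    have e1 : ∀ ω, discreteIntegral W σ D (m + 1) ω ^ 2
        = S ω ^ 2 + 2 * (S ω * D m ω * Y ω) + D m ω ^ 2 * Y ω ^ 2 := fun ω => by
      simp only [hS, hY, discreteIntegral, Finset.sum_range_succ]; ring
    have e2 : ∀ ω, discreteVariation σ D (m + 1) ω
        = discreteVariation σ D m ω + D m ω ^ 2 * ((σ (m + 1) : ℝ) - σ m) := fun ω => by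
      simp only [discreteVariation, Finset.sum_range_succ]
    have i2 : Integrable (fun ω => S ω * D m ω * Y ω) P := by
      refine (hSp.integrable_mul hDY).congr (ae_of_all _ fun ω => ?_)
      simp [mul_assoc]
    have i3 : Integrable (fun ω => D m ω ^ 2 * Y ω ^ 2) P := by
      refine hDY.integrable_sq.congr (ae_of_all _ fun ω => ?_)
      simp [mul_pow]
    have h2 : ∫ ω, S ω * D m ω * Y ω ∂P = 0 := by
      have := hW.integral_mul_increment hle
        ((hW.stronglyMeasurable_discreteIntegral hσ hD m).mul (hD m)) id measurable_id
      simp only [id, hW.integral_increment, mul_zero] at this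
      exact this
    have h3 : ∫ ω, D m ω ^ 2 * Y ω ^ 2 ∂P = ∫ ω, D m ω ^ 2 * ((σ (m + 1) : ℝ) - σ m) ∂P := by
      have := hW.integral_mul_increment hle ((hD m).pow 2) (fun x => x ^ 2) (by fun_prop)
      rw [hW.integral_increment_sq hle] at this
      rw [integral_mul_const]
      exact this
    simp_rw [e1, e2]
    have i12 : Integrable (fun ω => S ω ^ 2 + 2 * (S ω * D m ω * Y ω)) P :=
      hSp.integrable_sq.add (i2.const_mul 2)
    rw [integral_add i12 i3,
      integral_add hSp.integrable_sq (i2.const_mul 2), integral_const_mul, h2, h3, ih,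
      integral_add (hQ m) ((hDp m).integrable_sq.mul_const _)]
    ring

/-- Lenglart's inequality for discrete integrands. -/
lemma measure_le_discreteIntegral [IsProbabilityMeasure P] (hW : IsBrownianMotion 𝓕 P W)
    (hσ : Monotone σ) (hD : ∀ l, StronglyMeasurable[𝓕 (σ l)] (D l)) {C : ℝ}
    (hC : ∀ l ω, |D l ω| ≤ C) (m : ℕ) {ε δ : ℝ} (hε : 0 < ε) (hδ : 0 ≤ δ) :
    P {ω | ε ≤ |discreteIntegral W σ D m ω|}
      ≤ P {ω | δ ≤ discreteVariation σ D m ω} + ENNReal.ofReal (δ / ε ^ 2) := by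
  classical
  have hterm : ∀ l ω, 0 ≤ D l ω ^ 2 * ((σ (l + 1) : ℝ) - σ l) := fun l ω =>
    mul_nonneg (sq_nonneg _) (sub_nonneg.2 (by exact_mod_cast hσ l.le_succ))
  have hQmono : ∀ ω, Monotone fun k => discreteVariation σ D k ω := fun ω =>
    monotone_nat_of_le_succ fun k => by
      simp only [discreteVariation, Finset.sum_range_succ]
      linarith [hterm k ω]
  -- The variation up to `l + 1` involves only `D 0, …, D l` and deterministic times, so it is known
  -- at time `σ l`. The cut-off can therefore act before the level `δ` is reached, with no
  -- overshoot.
  set D' : ℕ → Ω → ℝ := fun l => {ω | discreteVariation σ D (l + 1) ω < δ}.indicator (D l)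
    with hD'
  have hQm : ∀ l, StronglyMeasurable[𝓕 (σ l)] (discreteVariation σ D (l + 1)) := fun l => by
    unfold discreteVariation
    refine Finset.stronglyMeasurable_fun_sum _ fun k hk => ?_
    have hk : k ≤ l := Nat.lt_succ_iff.1 (Finset.mem_range.1 hk)
    exact (((hD k).mono (𝓕.mono (hσ hk))).pow 2).mul_const _
  have hDm' : ∀ l, StronglyMeasurable[𝓕 (σ l)] (D' l) := fun l =>
    (hD l).indicator (measurableSet_lt (hQm l).measurable measurable_const)
  have hC' : ∀ l ω, |D' l ω| ≤ C := fun l ω => by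
    by_cases h : ω ∈ {ω | discreteVariation σ D (l + 1) ω < δ}
    · simp only [hD', Set.indicator_of_mem h]; exact hC l ω
    · simp only [hD', Set.indicator_of_notMem h, abs_zero]; exact (abs_nonneg _).trans (hC l ω)
  have hbound : ∀ k ω, discreteVariation σ D' k ω ≤ δ := by
    intro k ω
    induction k with
    | zero => simpa [discreteVariation] using hδ
    | succ k ih =>
      by_cases h : discreteVariation σ D (k + 1) ω < δ
      · refine le_trans (Finset.sum_le_sum fun l _ => ?_) h.le
        by_cases hl : ω ∈ {ω | discreteVariation σ D (l + 1) ω < δ}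
        · simp only [hD', Set.indicator_of_mem hl]; exact le_rfl
        · simp only [hD', Set.indicator_of_notMem hl]; simpa using hterm l ω
      · rw [discreteVariation, Finset.sum_range_succ]
        have : D' k ω = 0 := Set.indicator_of_notMem
          (s := {ω | discreteVariation σ D (k + 1) ω < δ}) h _
        rw [this]
        simpa [discreteVariation] using ih
  have heq : ∀ ω, discreteVariation σ D m ω < δ →
      discreteIntegral W σ D' m ω = discreteIntegral W σ D m ω := fun ω h =>
    Finset.sum_congr rfl fun l hl => by
      have : D' l ω = D l ω := Set.indicator_of_mem
        (s := {ω | discreteVariation σ D (l + 1) ω < δ})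
        ((hQmono ω (Finset.mem_range.1 hl)).trans_lt h) _
      rw [this]
  have hsub : {ω | ε ≤ |discreteIntegral W σ D m ω|} ⊆ {ω | δ ≤ discreteVariation σ D m ω} ∪
      {ω | ε ^ 2 ≤ discreteIntegral W σ D' m ω ^ 2} := fun ω hω => by
    by_cases h : discreteVariation σ D m ω < δ
    · right
      change ε ^ 2 ≤ _
      rw [heq ω h, ← sq_abs (discreteIntegral W σ D m ω)]
      exact pow_le_pow_left₀ hε.le hω 2
    · exact Or.inl (not_lt.1 h)
  refine (measure_mono hsub).trans ((measure_union_le _ _).trans (add_le_add le_rfl ?_))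
  have hint : ∫ ω, discreteIntegral W σ D' m ω ^ 2 ∂P ≤ δ := by
    rw [hW.integral_discreteIntegral_sq hσ hDm' hC' m]
    refine (integral_mono_of_nonneg (ae_of_all _ fun ω => ?_) (integrable_const δ)
      (ae_of_all _ fun ω => hbound m ω)).trans (by simp)
    exact Finset.sum_nonneg fun l _ =>
      mul_nonneg (sq_nonneg _) (sub_nonneg.2 (by exact_mod_cast hσ l.le_succ))
  have hM := mul_meas_ge_le_integral_of_nonneg (μ := P)
    (f := fun ω => discreteIntegral W σ D' m ω ^ 2) (ae_of_all _ fun ω => sq_nonneg _)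
    (hW.memLp_discreteIntegral hDm' hC' m).integrable_sq (ε ^ 2)
  rw [← ofReal_measureReal]
  refine ENNReal.ofReal_le_ofReal ?_
  rw [le_div_iff₀ (by positivity), mul_comm]
  exact hM.trans hint

end IsBrownianMotion

/-! ### Finite time grids and telescoping sums. -/

lemma exists_monotone_enumeration (A : Finset ℝ≥0) (hA : A.Nonempty) :
    ∃ (σ : ℕ → ℝ≥0) (m : ℕ), Monotone σ ∧ (∀ l, σ l ∈ A) ∧ ∀ x ∈ A, ∃ p ≤ m, σ p = x := by
  have hpos : 0 < A.card := hA.card_pos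
  refine ⟨fun l => A.orderEmbOfFin rfl ⟨min l (A.card - 1), by omega⟩, A.card - 1,
    fun i j hij => ?_, fun l => Finset.orderEmbOfFin_mem _ _ _, fun x hx => ?_⟩
  · apply (A.orderEmbOfFin rfl).monotone
    simp only [Fin.mk_le_mk]
    omega
  · have : x ∈ Set.range (A.orderEmbOfFin rfl) := by
      rw [Finset.range_orderEmbOfFin]; exact hx
    obtain ⟨p, rfl⟩ := this
    refine ⟨p, Nat.le_sub_one_of_lt p.2, ?_⟩
    exact congrArg _ (Fin.ext (min_eq_left (Nat.le_sub_one_of_lt p.2)))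

lemma sum_increments_Iic {σ : ℕ → ℝ≥0} (hσ : Monotone σ) (g : ℝ≥0 → ℝ) {m q : ℕ} (hq : q ≤ m) :
    ∑ l ∈ Finset.range m, (Set.Iic (σ q)).indicator (fun _ => g (σ (l + 1)) - g (σ l)) (σ (l + 1))
      = g (σ q) - g (σ 0) := by
  rw [← Finset.sum_range_sub (fun l => g (σ l)) q]
  symm
  rw [← Finset.sum_subset (Finset.range_mono hq)]
  · refine Finset.sum_congr rfl fun l hl => ?_
    rw [Set.indicator_of_mem]
    exact hσ (Finset.mem_range.1 hl)
  · intro l _ hl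
    rw [Finset.mem_range, not_lt] at hl
    -- The grid may repeat points: past index `q`, a right endpoint still in `Iic (σ q)` belongs to
    -- a degenerate step with zero increment.
    by_cases h : σ (l + 1) ≤ σ q
    · have : σ (l + 1) = σ l := le_antisymm (h.trans (hσ hl)) (hσ l.le_succ)
      simp [this]
    · exact Set.indicator_of_notMem (s := Set.Iic (σ q)) h _

lemma sum_increments_Ioc {σ : ℕ → ℝ≥0} (hσ : Monotone σ) (g : ℝ≥0 → ℝ) {m p q : ℕ}
    (hp : p ≤ m) (hq : q ≤ m) (hpq : σ p ≤ σ q) :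
    ∑ l ∈ Finset.range m,
      (Set.Ioc (σ p) (σ q)).indicator (fun _ => g (σ (l + 1)) - g (σ l)) (σ (l + 1))
      = g (σ q) - g (σ p) := by
  have h : g (σ q) - g (σ p) = (g (σ q) - g (σ 0)) - (g (σ p) - g (σ 0)) := by ring
  rw [h, ← sum_increments_Iic hσ g hq, ← sum_increments_Iic hσ g hp, ← Finset.sum_sub_distrib]
  refine Finset.sum_congr rfl fun l _ => ?_
  by_cases h1 : σ (l + 1) ≤ σ p
  · rw [Set.indicator_of_notMem (fun h => (not_lt.2 h1) h.1),
      Set.indicator_of_mem (s := Set.Iic (σ q)) (h1.trans hpq),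
      Set.indicator_of_mem (s := Set.Iic (σ p)) h1, sub_self]
  · rw [Set.indicator_of_notMem (s := Set.Iic (σ p)) h1, sub_zero]
    by_cases h2 : σ (l + 1) ≤ σ q
    · rw [Set.indicator_of_mem (s := Set.Iic (σ q)) h2,
        Set.indicator_of_mem (s := Set.Ioc (σ p) (σ q)) ⟨not_le.1 h1, h2⟩]
    · rw [Set.indicator_of_notMem (s := Set.Iic (σ q)) h2,
        Set.indicator_of_notMem (fun h => h2 h.2)]

/-- Reconciles `SimpleProcess.integral`, whose times are truncated to `[s, t]`, with
`SimpleProcess.eval`, whose times are not. -/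
lemma mem_Ioc_clamp_iff {s t r u v : ℝ≥0} (hr : r ∈ Set.Ioc s t) :
    r ∈ Set.Ioc (max s (min u t)) (max s (min v t)) ↔ r ∈ Set.Ioc u v := by
  obtain ⟨h1, h2⟩ := hr
  simp only [Set.mem_Ioc, max_lt_iff, le_max_iff, min_lt_iff, le_min_iff, h1, h2, not_le.2 h1,
    true_and, false_or, and_true]
  constructor
  · rintro ⟨h | h, h'⟩
    · exact ⟨h, h'⟩
    · exact absurd h (not_lt.2 h2)
  · exact fun h => ⟨Or.inl h.1, h.2⟩

/-! ### Simple processes along a common refinement. -/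

namespace SimpleProcess

variable {η : SimpleProcess 𝓕} {s t : ℝ≥0} {σ : ℕ → ℝ≥0} {m : ℕ}

/-- The partition `σ 0, …, σ m` of `[s, t]` contains the times of `η`, truncated to `[s, t]`. -/
structure IsRefinement (η : SimpleProcess 𝓕) (s t : ℝ≥0) (σ : ℕ → ℝ≥0) (m : ℕ) : Prop where
  mono : Monotone σ
  left_le : ∀ l, s ≤ σ l
  le_right : ∀ l, σ l ≤ t
  exists_eq : ∀ i ≤ η.n, ∃ p ≤ m, σ p = max s (min (η.τ i) t)

lemma clamp_mono (s t : ℝ≥0) : Monotone fun u : ℝ≥0 => max s (min u t) := fun _ _ h =>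
  max_le_max le_rfl (min_le_min h le_rfl)

lemma IsRefinement.integral_eq (h : η.IsRefinement s t σ m) (W : ℝ≥0 → Ω → ℝ) (ω : Ω) :
    η.integral W s t ω = discreteIntegral W σ (fun l => η.eval (σ (l + 1))) m ω := by
  simp only [integral, discreteIntegral, eval, Finset.sum_mul]
  rw [Finset.sum_comm]
  refine Finset.sum_congr rfl fun i hi => ?_
  have hi : i < η.n := Finset.mem_range.1 hi
  obtain ⟨p, hp, hpe⟩ := h.exists_eq i hi.le
  obtain ⟨q, hq, hqe⟩ := h.exists_eq (i + 1) hi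
  have hpq : σ p ≤ σ q := by
    rw [hpe, hqe]
    exact clamp_mono s t (η.mono i.le_succ)
  rw [← hpe, ← hqe, ← sum_increments_Ioc h.mono (fun u => W u ω) hp hq hpq, Finset.mul_sum]
  refine Finset.sum_congr rfl fun l _ => ?_
  -- A right endpoint equal to `s` escapes the clamping equivalence, but then the step is
  -- degenerate.
  rcases (h.left_le (l + 1)).eq_or_lt with hs | hs
  · have : σ l = σ (l + 1) := le_antisymm (h.mono l.le_succ) (hs ▸ h.left_le l)
    simp [this]
  · have hiff := mem_Ioc_clamp_iff (u := η.τ i) (v := η.τ (i + 1)) ⟨hs, h.le_right (l + 1)⟩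
    rw [← hpe, ← hqe] at hiff
    by_cases hm : σ (l + 1) ∈ Set.Ioc (σ p) (σ q)
    · rw [Set.indicator_of_mem hm, Set.indicator_of_mem (hiff.1 hm)]
    · rw [Set.indicator_of_notMem hm, Set.indicator_of_notMem (fun h => hm (hiff.2 h))]
      simp

/-- No time of `η` lies in the open interval between two consecutive partition points. -/
lemma IsRefinement.time_le (h : η.IsRefinement s t σ m) {i l : ℕ} (hi : i ≤ η.n)
    (hlt : η.τ i < σ (l + 1)) : η.τ i ≤ σ l := by
  obtain ⟨p, -, hpe⟩ := h.exists_eq i hi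
  rcases le_or_gt (η.τ i) s with hs | hs
  · exact hs.trans (h.left_le l)
  · have : σ p = η.τ i := by
      rw [hpe, min_eq_left (hlt.le.trans (h.le_right _)), max_eq_right hs.le]
    rw [← this] at hlt ⊢
    exact h.mono (Nat.lt_succ_iff.1 (h.mono.reflect_lt hlt))

lemma IsRefinement.eval_eq (h : η.IsRefinement s t σ m) {l : ℕ} {r : ℝ≥0}
    (hr : r ∈ Set.Ioc (σ l) (σ (l + 1))) (ω : Ω) : η.eval r ω = η.eval (σ (l + 1)) ω := by
  refine Finset.sum_congr rfl fun i hi => ?_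
  have key : ∀ j ≤ η.n, η.τ j < r ↔ η.τ j < σ (l + 1) := fun j hj =>
    ⟨fun hj' => hj'.trans_le hr.2, fun hj' => (h.time_le hj hj').trans_lt hr.1⟩
  have hi : i < η.n := Finset.mem_range.1 hi
  have hiff : r ∈ Set.Ioc (η.τ i) (η.τ (i + 1)) ↔ σ (l + 1) ∈ Set.Ioc (η.τ i) (η.τ (i + 1)) := by
    rw [Set.mem_Ioc, Set.mem_Ioc, key i hi.le, ← not_lt, key (i + 1) hi, not_lt]
  by_cases hm : r ∈ Set.Ioc (η.τ i) (η.τ (i + 1))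
  · rw [Set.indicator_of_mem hm, Set.indicator_of_mem (hiff.1 hm)]
  · rw [Set.indicator_of_notMem hm, Set.indicator_of_notMem fun h => hm (hiff.2 h)]

/-- Predictability: a coefficient active at the right endpoint starts strictly before it, hence no
later than the left endpoint, where it is already known. -/
lemma IsRefinement.stronglyMeasurable_eval (h : η.IsRefinement s t σ m) (l : ℕ) :
    StronglyMeasurable[𝓕 (σ l)] (η.eval (σ (l + 1))) := by
  unfold eval
  refine Finset.stronglyMeasurable_fun_sum _ fun i hi => ?_
  by_cases hm : σ (l + 1) ∈ Set.Ioc (η.τ i) (η.τ (i + 1))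
  · simp only [Set.indicator_of_mem hm]
    exact (η.measurable_coeff i).mono
      (𝓕.mono (h.time_le (Finset.mem_range.1 hi).le hm.1))
  · simp only [Set.indicator_of_notMem hm]
    exact stronglyMeasurable_const

lemma exists_abs_eval_le (η : SimpleProcess 𝓕) : ∃ C : ℝ, ∀ r ω, |η.eval r ω| ≤ C := by
  obtain ⟨C, hC⟩ := η.bounded_coeff
  refine ⟨η.n * C, fun r ω => (Finset.abs_sum_le_sum_abs _ _).trans ?_⟩
  refine (Finset.sum_le_card_nsmul _ _ C fun i _ => ?_).trans (by simp)
  by_cases hm : r ∈ Set.Ioc (η.τ i) (η.τ (i + 1))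
  · rw [Set.indicator_of_mem hm]; exact hC i ω
  · rw [Set.indicator_of_notMem hm, abs_zero]; exact (abs_nonneg _).trans (hC i ω)

lemma measurable_eval (η : SimpleProcess 𝓕) (ω : Ω) : Measurable fun r => η.eval r ω :=
  Finset.measurable_fun_sum _ fun _ _ => measurable_const.indicator measurableSet_Ioc

lemma exists_isRefinement (η θ : SimpleProcess 𝓕) (hst : s ≤ t) :
    ∃ σ m, η.IsRefinement s t σ m ∧ θ.IsRefinement s t σ m := by
  classical
  set f := fun u : ℝ≥0 => max s (min u t)
  set A : Finset ℝ≥0 := (Finset.range (η.n + 1)).image (fun i => f (η.τ i)) ∪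
    (Finset.range (θ.n + 1)).image (fun i => f (θ.τ i)) with hA
  have hAη : ∀ i ≤ η.n, f (η.τ i) ∈ A := fun i hi => Finset.mem_union_left _
    (Finset.mem_image_of_mem _ (Finset.mem_range.2 (Nat.lt_succ_of_le hi)))
  have hAθ : ∀ i ≤ θ.n, f (θ.τ i) ∈ A := fun i hi => Finset.mem_union_right _
    (Finset.mem_image_of_mem _ (Finset.mem_range.2 (Nat.lt_succ_of_le hi)))
  have hIcc : ∀ x ∈ A, s ≤ x ∧ x ≤ t := fun x hx => by
    rcases Finset.mem_union.1 hx with h | h <;> obtain ⟨i, -, rfl⟩ := Finset.mem_image.1 h <;>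
      exact ⟨le_max_left _ _, max_le hst (min_le_right _ _)⟩
  obtain ⟨σ, m, hmono, hmem, hex⟩ := exists_monotone_enumeration A ⟨_, hAη 0 (Nat.zero_le _)⟩
  exact ⟨σ, m, ⟨hmono, fun l => (hIcc _ (hmem l)).1, fun l => (hIcc _ (hmem l)).2,
    fun i hi => hex _ (hAη i hi)⟩, ⟨hmono, fun l => (hIcc _ (hmem l)).1,
    fun l => (hIcc _ (hmem l)).2, fun i hi => hex _ (hAθ i hi)⟩⟩

/-- The quadratic variation of the difference of two simple processes along a common refinement
is dominated by the squared `L²` distance of their paths. -/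
lemma IsRefinement.discreteVariation_le {θ : SimpleProcess 𝓕} (hη : η.IsRefinement s t σ m)
    (hθ : θ.IsRefinement s t σ m) (ω : Ω) :
    ENNReal.ofReal (discreteVariation σ
        (fun l ω => η.eval (σ (l + 1)) ω - θ.eval (σ (l + 1)) ω) m ω)
      ≤ ∫⁻ r in Set.Ioc (s : ℝ) t, ‖η.eval r.toNNReal ω - θ.eval r.toNNReal ω‖ₑ ^ 2 := by
  have hR : Monotone fun l => (σ l : ℝ) := fun i j h => by exact_mod_cast hη.mono h
  set F : ℝ → ℝ≥0∞ := fun r => ‖η.eval r.toNNReal ω - θ.eval r.toNNReal ω‖ₑ ^ 2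
  have hstep : ∀ l, ENNReal.ofReal ((η.eval (σ (l + 1)) ω - θ.eval (σ (l + 1)) ω) ^ 2
      * ((σ (l + 1) : ℝ) - σ l)) = ∫⁻ r in Set.Ioc (σ l : ℝ) (σ (l + 1)), F r := fun l => by
    have : ∀ r ∈ Set.Ioc (σ l : ℝ) (σ (l + 1)),
        F r = ‖η.eval (σ (l + 1)) ω - θ.eval (σ (l + 1)) ω‖ₑ ^ 2 := fun r hr => by
      have hr' : r.toNNReal ∈ Set.Ioc (σ l) (σ (l + 1)) :=
        ⟨Real.lt_toNNReal_iff_coe_lt.2 hr.1, Real.toNNReal_le_iff_le_coe.2 hr.2⟩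
      simp only [F, hη.eval_eq hr', hθ.eval_eq hr']
    rw [setLIntegral_congr_fun measurableSet_Ioc this, setLIntegral_const, Real.volume_Ioc,
      ENNReal.ofReal_mul (sq_nonneg _), ← sq_abs, ENNReal.ofReal_pow (abs_nonneg _),
      ← Real.norm_eq_abs, ofReal_norm]
  have hsum : ∀ k, ENNReal.ofReal (discreteVariation σ
      (fun l ω => η.eval (σ (l + 1)) ω - θ.eval (σ (l + 1)) ω) k ω)
      = ∫⁻ r in Set.Ioc (σ 0 : ℝ) (σ k), F r := fun k => by
    induction k with
    | zero => simp [discreteVariation]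
    | succ k ih =>
      have hnn : ∀ l, 0 ≤ (η.eval (σ (l + 1)) ω - θ.eval (σ (l + 1)) ω) ^ 2
          * ((σ (l + 1) : ℝ) - σ l) := fun l =>
        mul_nonneg (sq_nonneg _) (sub_nonneg.2 (hR l.le_succ))
      rw [discreteVariation] at ih ⊢
      rw [Finset.sum_range_succ, ENNReal.ofReal_add (Finset.sum_nonneg fun l _ => hnn l) (hnn k),
        ih, hstep, ← Set.Ioc_union_Ioc_eq_Ioc (hR (Nat.zero_le k)) (hR k.le_succ),
        lintegral_union measurableSet_Ioc
          (Set.disjoint_left.2 fun x hx hx' => (not_lt.2 hx.2) hx'.1)]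
  rw [hsum]
  exact lintegral_mono_set (Set.Ioc_subset_Ioc (by exact_mod_cast hη.left_le 0)
    (by exact_mod_cast hη.le_right m))

end SimpleProcess

/-! ### Uniqueness of the Itô integral. -/

/-- Lenglart's inequality for the difference of two simple processes. -/
lemma IsBrownianMotion.measure_le_integral_sub [IsProbabilityMeasure P]
    (hW : IsBrownianMotion 𝓕 P W) (η θ : SimpleProcess 𝓕) {s t : ℝ≥0} (hst : s ≤ t) {ε δ : ℝ}
    (hε : 0 < ε) (hδ : 0 < δ) :
    P {ω | ε ≤ |η.integral W s t ω - θ.integral W s t ω|}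
      ≤ P {ω | ENNReal.ofReal δ ≤ ∫⁻ r in Set.Ioc (s : ℝ) t,
          ‖η.eval r.toNNReal ω - θ.eval r.toNNReal ω‖ₑ ^ 2} + ENNReal.ofReal (δ / ε ^ 2) := by
  obtain ⟨σ, m, hη, hθ⟩ := η.exists_isRefinement θ hst
  set D : ℕ → Ω → ℝ := fun l ω => η.eval (σ (l + 1)) ω - θ.eval (σ (l + 1)) ω with hD
  have hint : ∀ ω, η.integral W s t ω - θ.integral W s t ω = discreteIntegral W σ D m ω := by
    intro ω
    rw [hη.integral_eq, hθ.integral_eq, discreteIntegral, discreteIntegral, discreteIntegral,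
      ← Finset.sum_sub_distrib]
    exact Finset.sum_congr rfl fun l _ => by simp only [hD]; ring
  obtain ⟨C, hC⟩ := η.exists_abs_eval_le
  obtain ⟨C', hC'⟩ := θ.exists_abs_eval_le
  have h := hW.measure_le_discreteIntegral hη.mono (D := D)
    (fun l => (hη.stronglyMeasurable_eval l).sub (hθ.stronglyMeasurable_eval l))
    (C := C + C') (fun l ω => (abs_sub _ _).trans (add_le_add (hC _ ω) (hC' _ ω))) m hε hδ.le
  simp_rw [hint]
  refine h.trans (add_le_add (measure_mono fun ω hω => ?_) le_rfl)
  exact (ENNReal.ofReal_le_ofReal hω).trans (hη.discreteVariation_le hθ ω)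

lemma enorm_sub_sq_le (x y z : ℝ) : ‖x - y‖ₑ ^ 2 ≤ 2 * ‖x - z‖ₑ ^ 2 + 2 * ‖y - z‖ₑ ^ 2 := by
  have h : ∀ w : ℝ, ‖w‖ₑ ^ 2 = ENNReal.ofReal (w ^ 2) := fun w => by
    rw [← ofReal_norm, ← ENNReal.ofReal_pow (norm_nonneg _), Real.norm_eq_abs, sq_abs]
  rw [h, h, h, show (2 : ℝ≥0∞) = ENNReal.ofReal 2 by simp, ← ENNReal.ofReal_mul (by norm_num),
    ← ENNReal.ofReal_mul (by norm_num), ← ENNReal.ofReal_add (by positivity) (by positivity)]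
  exact ENNReal.ofReal_le_ofReal (by nlinarith [sq_nonneg (x + y - 2 * z)])

/-- Two approximations of the same integrand have approximately the same integrals. -/
lemma IsBrownianMotion.tendsto_measure_integral_sub [IsProbabilityMeasure P]
    (hW : IsBrownianMotion 𝓕 P W) {H : ℝ≥0 → Ω → ℝ}
    (hH : ∀ᵐ ω ∂P, Measurable fun r => H r ω) {η θ : ℕ → SimpleProcess 𝓕} {s t : ℝ≥0}
    (hst : s ≤ t)
    (hη : ∀ ε : ℝ≥0∞, 0 < ε → Tendsto (fun k => P {ω | ε ≤ ∫⁻ r in Set.Ioc (s : ℝ) t,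
        ‖(η k).eval r.toNNReal ω - H r.toNNReal ω‖ₑ ^ 2}) atTop (𝓝 0))
    (hθ : ∀ ε : ℝ≥0∞, 0 < ε → Tendsto (fun k => P {ω | ε ≤ ∫⁻ r in Set.Ioc (s : ℝ) t,
        ‖(θ k).eval r.toNNReal ω - H r.toNNReal ω‖ₑ ^ 2}) atTop (𝓝 0))
    {ε : ℝ} (hε : 0 < ε) :
    Tendsto (fun k => P {ω | ε ≤ |(η k).integral W s t ω - (θ k).integral W s t ω|})
      atTop (𝓝 0) := by
  have hdiff : ∀ δ : ℝ, 0 < δ → Tendsto (fun k => P {ω | ENNReal.ofReal δ ≤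
      ∫⁻ r in Set.Ioc (s : ℝ) t, ‖(η k).eval r.toNNReal ω - (θ k).eval r.toNNReal ω‖ₑ ^ 2})
      atTop (𝓝 0) := by
    intro δ hδ
    -- The quarter matches `|x - y|² ≤ 2 |x - z|² + 2 |y - z|²`: two errors below `δ / 4` give a
    -- total below `δ`.
    have hδ4 : 0 < ENNReal.ofReal (δ / 4) := ENNReal.ofReal_pos.2 (by positivity)
    have hadd := (hη _ hδ4).add (hθ _ hδ4)
    rw [add_zero] at hadd
    refine tendsto_of_tendsto_of_tendsto_of_le_of_le tendsto_const_nhds hadd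
      (fun _ => zero_le) fun k => ?_
    refine (measure_mono_ae ?_).trans (measure_union_le _ _)
    filter_upwards [hH] with ω hω hmem
    by_contra hcon
    have hcon' := not_or.1 hcon
    have h1 : (∫⁻ r in Set.Ioc (s : ℝ) t,
        ‖(η k).eval r.toNNReal ω - H r.toNNReal ω‖ₑ ^ 2) < ENNReal.ofReal (δ / 4) := not_le.1 fun h => hcon'.1 h
    have h2 : (∫⁻ r in Set.Ioc (s : ℝ) t,
        ‖(θ k).eval r.toNNReal ω - H r.toNNReal ω‖ₑ ^ 2) < ENNReal.ofReal (δ / 4) := not_le.1 fun h => hcon'.2 h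
    have hmeas : ∀ ζ : SimpleProcess 𝓕,
        Measurable fun r : ℝ => ‖ζ.eval r.toNNReal ω - H r.toNNReal ω‖ₑ ^ 2 := fun ζ =>
      (((ζ.measurable_eval ω).comp measurable_real_toNNReal).sub
        (hω.comp measurable_real_toNNReal)).enorm.pow_const 2
    have hle : ENNReal.ofReal δ ≤
        2 * (∫⁻ r in Set.Ioc (s : ℝ) t, ‖(η k).eval r.toNNReal ω - H r.toNNReal ω‖ₑ ^ 2)
        + 2 * ∫⁻ r in Set.Ioc (s : ℝ) t, ‖(θ k).eval r.toNNReal ω - H r.toNNReal ω‖ₑ ^ 2 := by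
      rw [← lintegral_const_mul _ (hmeas _), ← lintegral_const_mul _ (hmeas _),
        ← lintegral_add_left ((hmeas _).const_mul 2)]
      exact le_trans hmem (lintegral_mono fun r => enorm_sub_sq_le _ _ _)
    refine absurd hle (not_le.2 ?_)
    have h3 : ENNReal.ofReal δ = 2 * ENNReal.ofReal (δ / 4) + 2 * ENNReal.ofReal (δ / 4) := by
      rw [show (2 : ℝ≥0∞) = ENNReal.ofReal 2 by simp, ← ENNReal.ofReal_mul (by norm_num),
        ← ENNReal.ofReal_add (by positivity) (by positivity)]
      congr 1; ring
    rw [h3]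
    exact ENNReal.add_lt_add ((ENNReal.mul_lt_mul_iff_right (by simp) (by simp)).2 h1)
      ((ENNReal.mul_lt_mul_iff_right (by simp) (by simp)).2 h2)
  rw [ENNReal.tendsto_nhds_zero]
  intro e he
  have he2 : 0 < e / 2 := ENNReal.half_pos he.ne'
  obtain ⟨x, hx0, hxe⟩ := ENNReal.lt_iff_exists_nnreal_btwn.1 he2
  have hx : (0 : ℝ) < x := by exact_mod_cast hx0
  -- With `δ = x * ε ^ 2`, the second Lenglart term is exactly `x < e / 2`.
  filter_upwards [ENNReal.tendsto_nhds_zero.1 (hdiff (x * ε ^ 2) (by positivity)) _ he2] with k hk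
  refine (hW.measure_le_integral_sub (η k) (θ k) hst hε
    (δ := x * ε ^ 2) (by positivity)).trans ?_
  rw [← ENNReal.add_halves e, mul_div_assoc, div_self (by positivity), mul_one,
    ENNReal.ofReal_coe_nnreal]
  exact add_le_add hk hxe.le

namespace IsItoIntegral

variable {s : ℝ≥0} {H Z Z' : ℝ≥0 → Ω → ℝ}

lemma ae_eq_at [IsProbabilityMeasure P] (hW : IsBrownianMotion 𝓕 P W)
    (hZ : IsItoIntegral 𝓕 P W s H Z) (hZ' : IsItoIntegral 𝓕 P W s H Z') {t : ℝ≥0} (hst : s ≤ t) :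
    Z t =ᵐ[P] Z' t := by
  obtain ⟨η, hη, hηZ⟩ := hZ.exists_approx
  obtain ⟨θ, hθ, hθZ⟩ := hZ'.exists_approx
  refine tendstoInMeasure_ae_unique (hηZ t hst) ?_
  rw [tendstoInMeasure_iff_norm]
  intro ε hε
  have h1 := hW.tendsto_measure_integral_sub hZ.measurable_paths hst (hη t) (hθ t) (half_pos hε)
  have h2 := tendstoInMeasure_iff_norm.1 (hθZ t hst) _ (half_pos hε)
  have hadd := h1.add h2
  rw [add_zero] at hadd
  refine tendsto_of_tendsto_of_tendsto_of_le_of_le tendsto_const_nhds hadd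
    (fun _ => zero_le) fun k => (measure_mono fun ω hω => ?_).trans (measure_union_le _ _)
  by_contra hcon
  have hcon' := not_or.1 hcon
  have h1 : |(η k).integral W s t ω - (θ k).integral W s t ω| < ε / 2 :=
    not_le.1 fun h => hcon'.1 h
  have h2 : ‖(θ k).integral W s t ω - Z' t ω‖ < ε / 2 := not_le.1 fun h => hcon'.2 h
  have h3 := abs_sub_le ((η k).integral W s t ω) ((θ k).integral W s t ω) (Z' t ω)
  have h4 : ε ≤ |(η k).integral W s t ω - Z' t ω| := hω
  rw [Real.norm_eq_abs] at h2
  linarith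

/-- Continuous versions of the Itô integral are indistinguishable. -/
lemma ae_eq [IsProbabilityMeasure P] (hW : IsBrownianMotion 𝓕 P W)
    (hZ : IsItoIntegral 𝓕 P W s H Z) (hZ' : IsItoIntegral 𝓕 P W s H Z') :
    ∀ᵐ ω ∂P, ∀ t, s ≤ t → Z t ω = Z' t ω := by
  have hdense : ∀ᵐ ω ∂P, ∀ n, Z (s + TopologicalSpace.denseSeq ℝ≥0 n) ω
      = Z' (s + TopologicalSpace.denseSeq ℝ≥0 n) ω :=
    ae_all_iff.2 fun n => hZ.ae_eq_at hW hZ' le_self_add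
  filter_upwards [hdense, hZ.continuous_paths, hZ'.continuous_paths] with ω hω hc hc' t hst
  have hmap : ∀ u : ℝ≥0, s + u ∈ Set.Ici s := fun u => Set.mem_Ici.2 le_self_add
  have heq : (fun u => Z (s + u) ω) = fun u => Z' (s + u) ω := by
    refine Continuous.ext_on (TopologicalSpace.denseRange_denseSeq ℝ≥0)
      (hc.comp_continuous (continuous_const.add continuous_id) hmap)
      (hc'.comp_continuous (continuous_const.add continuous_id) hmap) ?_
    rintro _ ⟨n, rfl⟩
    exact hω n
  have := congrFun heq (t - s)
  simpa only [add_tsub_cancel_of_le hst] using this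

end IsItoIntegral

/-! ### Changing the starting time of the integral. -/

lemma SimpleProcess.integral_eq_sub (η : SimpleProcess 𝓕) (W : ℝ≥0 → Ω → ℝ) {s t : ℝ≥0}
    (hst : s ≤ t) (ω : Ω) :
    η.integral W s t ω = η.integral W 0 t ω - η.integral W 0 s ω := by
  have key : ∀ u, W (max s (min u t)) ω = W (min u t) ω - W (min u s) ω + W s ω := fun u => by
    rcases le_total u s with h | h
    · rw [min_eq_left (h.trans hst), min_eq_left h, max_eq_left h]; ring
    · rw [min_eq_right h, max_eq_right (le_min h hst)]; ring
  simp only [integral, ← Finset.sum_sub_distrib]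
  refine Finset.sum_congr rfl fun i _ => ?_
  rw [key, key]
  simp only [zero_le, max_eq_right]
  ring

/-- The same simple processes serve for every starting time, because their integrals are additive
over adjacent intervals. -/
lemma IsItoIntegral.restart {H M : ℝ≥0 → Ω → ℝ} (hM : IsItoIntegral 𝓕 P W 0 H M) (s : ℝ≥0) :
    IsItoIntegral 𝓕 P W s H (fun t ω => M t ω - M s ω) where
  adapted := hM.adapted
  measurable_paths := hM.measurable_paths
  continuous_paths := by
    filter_upwards [hM.continuous_paths] with ω hω
    exact (hω.mono (Set.Ici_subset_Ici.2 zero_le)).sub continuousOn_const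
  exists_approx := by
    obtain ⟨η, hη, hηM⟩ := hM.exists_approx
    refine ⟨η, fun T ε hε => ?_, fun t hst => ?_⟩
    · refine tendsto_of_tendsto_of_tendsto_of_le_of_le tendsto_const_nhds (hη T ε hε)
        (fun _ => zero_le) fun k => measure_mono fun ω hω => ?_
      exact le_trans hω (lintegral_mono_set (Set.Ioc_subset_Ioc_left (by simp)))
    · rw [tendstoInMeasure_iff_norm]
      intro ε hε
      have hadd := (tendstoInMeasure_iff_norm.1 (hηM t zero_le) _ (half_pos hε)).add
        (tendstoInMeasure_iff_norm.1 (hηM s zero_le) _ (half_pos hε))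
      rw [add_zero] at hadd
      refine tendsto_of_tendsto_of_tendsto_of_le_of_le tendsto_const_nhds hadd
        (fun _ => zero_le) fun k => (measure_mono fun ω hω => ?_).trans (measure_union_le _ _)
      by_contra hcon
      have hcon' := not_or.1 hcon
      have h1 : ‖(η k).integral W 0 t ω - M t ω‖ < ε / 2 := not_le.1 fun h => hcon'.1 h
      have h2 : ‖(η k).integral W 0 s ω - M s ω‖ < ε / 2 := not_le.1 fun h => hcon'.2 h
      have h4 : ε ≤ ‖(η k).integral W s t ω - (M t ω - M s ω)‖ := hω
      rw [(η k).integral_eq_sub W hst, sub_sub_sub_comm] at h4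
      linarith [norm_sub_le ((η k).integral W 0 t ω - M t ω) ((η k).integral W 0 s ω - M s ω)]

/-! ### The pathwise linear equation. -/

lemma integral_exp_mul_sub (b s t : ℝ) :
    ∫ r in s..t, Real.exp (b * (t - r)) = expQuot b (t - s) := by
  unfold expQuot
  split_ifs with hb
  · simp [hb]
  · have hd : ∀ r ∈ Set.uIcc s t, HasDerivAt (fun r => -(Real.exp (b * (t - r)) / b))
        (Real.exp (b * (t - r))) r := fun r _ => by
      have h := ((((hasDerivAt_id r).const_sub t).const_mul b).exp.div_const b).neg
      refine h.congr_deriv ?_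
      simp only [id]
      field_simp
    rw [intervalIntegral.integral_eq_sub_of_hasDerivAt hd
      (Continuous.intervalIntegrable (by fun_prop) _ _)]
    simp
    ring

lemma integral_exp_mul_sub_mul_sub (b s t : ℝ) :
    ∫ r in s..t, Real.exp (b * (t - r)) * (r - s) = expQuot₂ b (t - s) := by
  unfold expQuot₂
  split_ifs with hb
  · have hd : ∀ r ∈ Set.uIcc s t, HasDerivAt (fun r => (r - s) ^ 2 / 2)
        (Real.exp (b * (t - r)) * (r - s)) r := fun r _ => by
      have h := (((hasDerivAt_id r).sub_const s).pow 2).div_const 2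
      refine h.congr_deriv ?_
      simp [hb]
    rw [intervalIntegral.integral_eq_sub_of_hasDerivAt hd
      (Continuous.intervalIntegrable (by fun_prop) _ _)]
    simp
  · have hd : ∀ r ∈ Set.uIcc s t, HasDerivAt
        (fun r => -(Real.exp (b * (t - r)) * (r - s) / b + Real.exp (b * (t - r)) / b ^ 2))
        (Real.exp (b * (t - r)) * (r - s)) r := fun r _ => by
      have he := (((hasDerivAt_id r).const_sub t).const_mul b).exp
      have h := (((he.mul ((hasDerivAt_id r).sub_const s)).div_const b).add
        (he.div_const (b ^ 2))).neg
      refine h.congr_deriv ?_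
      simp only [id]
      field_simp
      ring
    rw [intervalIntegral.integral_eq_sub_of_hasDerivAt hd
      (Continuous.intervalIntegrable (by fun_prop) _ _)]
    simp
    field_simp
    ring

/-- Variation of constants for the primitive of a continuous function `v` solving
`v t = v s + ∫_s^t (a + b v) + c z t`. -/
lemma integral_eq_of_linear_equation {a b c s t : ℝ} {v z : ℝ → ℝ} (hv : Continuous v)
    (hst : s ≤ t)
    (hz : ∀ r ∈ Set.Icc s t, v r = v s + (∫ x in s..r, (a + b * v x)) + c * z r) :
    ∫ r in s..t, v r = v s * expQuot b (t - s) + a * expQuot₂ b (t - s)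
      + c * ∫ r in s..t, Real.exp (b * (t - r)) * z r := by
  set u : ℝ → ℝ := fun r => ∫ x in s..r, v x with hu
  have hud : ∀ r, HasDerivAt u (v r) r := fun r => hv.integral_hasStrictDerivAt s r |>.hasDerivAt
  have huc : Continuous u := continuous_iff_continuousAt.2 fun r => (hud r).continuousAt
  -- By the equation, `v r - b * u r` equals `v s + a * (r - s) + c * z r`. Only `u` is
  -- differentiated, so `z` needs no regularity.
  have hd : ∀ r ∈ Set.uIcc s t, HasDerivAt (fun r => Real.exp (b * (t - r)) * u r)
      (Real.exp (b * (t - r)) * (v r - b * u r)) r := fun r _ => by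
    have h := (((hasDerivAt_id r).const_sub t).const_mul b).exp.mul (hud r)
    refine h.congr_deriv ?_
    simp only [id]
    ring
  have hftc := intervalIntegral.integral_eq_sub_of_hasDerivAt hd
    (Continuous.intervalIntegrable (by fun_prop) _ _)
  have hus : u s = 0 := by simp [hu]
  simp only [sub_self, mul_zero, Real.exp_zero, one_mul, hus, sub_zero] at hftc
  have hcz : c * ∫ r in s..t, Real.exp (b * (t - r)) * z r
      = ∫ r in s..t, (Real.exp (b * (t - r)) * (v r - b * u r)
          - v s * Real.exp (b * (t - r)) - a * (Real.exp (b * (t - r)) * (r - s))) := by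
    rw [← intervalIntegral.integral_const_mul]
    refine intervalIntegral.integral_congr fun r hr => ?_
    rw [Set.uIcc_of_le hst] at hr
    have h1 := hz r hr
    rw [intervalIntegral.integral_add (by simp)
      ((hv.const_mul b).intervalIntegrable _ _), intervalIntegral.integral_const,
      intervalIntegral.integral_const_mul, smul_eq_mul] at h1
    have h2 : c * z r = v r - v s - (r - s) * a - b * u r := by simp only [hu]; linarith
    rw [mul_left_comm, h2]
    ring
  have hi1 : IntervalIntegrable (fun r => Real.exp (b * (t - r)) * (v r - b * u r)) volume s t :=
    Continuous.intervalIntegrable (by fun_prop) _ _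
  have hi2 : IntervalIntegrable (fun r => v s * Real.exp (b * (t - r))) volume s t :=
    Continuous.intervalIntegrable (by fun_prop) _ _
  have hi3 : IntervalIntegrable (fun r => a * (Real.exp (b * (t - r)) * (r - s))) volume s t :=
    Continuous.intervalIntegrable (by fun_prop) _ _
  rw [hcz, intervalIntegral.integral_sub (hi1.sub hi2) hi3, intervalIntegral.integral_sub hi1 hi2,
    intervalIntegral.integral_const_mul, intervalIntegral.integral_const_mul,
    integral_exp_mul_sub, integral_exp_mul_sub_mul_sub, hftc]
  ring

end SquareRootProcess

end

theorem mainTheorem4 {Ω : Type*} {mΩ : MeasurableSpace Ω} (P : Measure Ω) [IsProbabilityMeasure P]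
    (𝓕 : Filtration ℝ≥0 mΩ) (W : ℝ≥0 → Ω → ℝ)
    (hW : SquareRootProcess.IsBrownianMotion 𝓕 P W)
    (a b c : ℝ) (ha : 0 ≤ a) (V : ℝ≥0 → Ω → ℝ)
    (hV : SquareRootProcess.IsSquareRootProcess 𝓕 P W a b c V) (s : ℝ≥0) :
    (∃ Z : ℝ≥0 → Ω → ℝ,
      SquareRootProcess.IsItoIntegral 𝓕 P W s (fun r ω => √(V r ω)) Z) ∧
    ∀ Z : ℝ≥0 → Ω → ℝ,
      SquareRootProcess.IsItoIntegral 𝓕 P W s (fun r ω => √(V r ω)) Z →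
      ∀ᵐ ω ∂P, ∀ t : ℝ≥0, s ≤ t →
        SquareRootProcess.integratedProcess V s t ω =
          V s ω * SquareRootProcess.expQuot b (t - s)
            + a * SquareRootProcess.expQuot₂ b (t - s)
            + c * ∫ r in (s : ℝ)..t, Real.exp (b * (t - r)) * Z r.toNNReal ω := by
  obtain ⟨M, hM, heq⟩ := hV.equation
  refine ⟨⟨_, hM.restart s⟩, fun Z hZ => ?_⟩
  filter_upwards [heq, hV.continuous_paths, hZ.ae_eq hW (hM.restart s)] with ω hω hc hZM t hst
  have hv : Continuous fun r : ℝ => V r.toNNReal ω := hc.comp continuous_real_toNNReal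
  have hst' : (s : ℝ) ≤ t := by exact_mod_cast hst
  have h := SquareRootProcess.integral_eq_of_linear_equation (a := a) (b := b) (c := c)
    (z := fun r => Z r.toNNReal ω) hv hst' fun r hr => by
      have hsr : s ≤ r.toNNReal := NNReal.le_toNNReal_of_coe_le hr.1
      have hr0 : (r.toNNReal : ℝ) = r := Real.coe_toNNReal r (s.coe_nonneg.trans hr.1)
      have hint : ∀ x y : ℝ, IntervalIntegrable (fun r => a + b * V r.toNNReal ω) volume x y :=
        fun x y => (continuous_const.add (hv.const_mul b)).intervalIntegrable x y
      have hadd := intervalIntegral.integral_add_adjacent_intervals (hint 0 s) (hint s r)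
      have h1 := hω r.toNNReal
      rw [hr0] at h1
      simp only [Real.toNNReal_coe]
      rw [hZM _ hsr]
      -- Subtracting the equation at `s` cancels `V 0` and the drift over `[0, s]`, and turns `M`
      -- into `M r - M s`.
      linarith [hω s]
  simpa only [SquareRootProcess.integratedProcess, Real.toNNReal_coe] using h
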